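/- Let $\mathrm{Homeo}_+(\mathbb{R})$ be the group of orientation-preserving homeomorphisms of the real line, and let $\widetilde{\mathrm{Homeo}}_+(\mathbb{R},0)$ be the group (under composition) of germs at $0$ of orientation-preserving local homeomorphisms of $\mathbb{R}$ fixing $0$. For a topological space $S$ with base point $s_0$, let $\widetilde{\mathrm{Homeo}}_+^{(S,s_0)}(\mathbb{R},0)$ be the group (under composition) of germs at the point $(0,s_0)$ of local homeomorphisms of $\mathbb{R}\times S$ that fix $(0,s_0)$ and have the form $(x,s)\mapsto (h_s(x),s)$, where each $h_s$ is an orientation-preserving local homeomorphism of $\mathbb{R}$. Here a local homeomorphism of a space is a homeomorphism between two of its open subsets, and a homomorphism is non-trivial if its image is not the trivial group. Let $G$ be a countable group. The following statements are equivalent: 1. $G$ has a non-trivial homomorphism into $\mathrm{Homeo}_+(\mathbb{R})$; 2. $G$ has a non-trivial homomorphism into $\widetilde{\mathrm{Homeo}}_+(\mathbb{R},0)$; 3. $G$ has a non-trivial homomorphism into $\widetilde{\mathrm{Homeo}}_+^{(S,0)}(\mathbb{R},0)$, where $S=\{0\}\cup\{\tfrac1n : n\in\mathbb{N},\ n\ge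 1\}\subset\mathbb{R}$ has the subspace topology and base point $0$; 4. $G$ has a non-trivial homomorphism into $\widetilde{\mathrm{Homeo}}_+^{(S,s_0)}(\mathbb{R},0)$ for some pointed metrizable topological space $(S,s_0)$. -/

import Mathlib

open Filter Topology

universe u v

noncomputable section

/-- Local homeomorphisms of `X` (homeomorphisms between open subsets of `X`) that are defined
at `x` and fix `x`. -/
structure PointedLocalHomeo (X : Type u) [TopologicalSpace X] (x : X) where
  toLocalHomeo : OpenPartialHomeomorph X X
  mem_source : x ∈ toLocalHomeo.source
  map_base : toLocalHomeo x = x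

namespace PointedLocalHomeo

variable {X : Type u} [TopologicalSpace X] {x : X}

/-- The identity of `X`. -/
def refl (X : Type u) [TopologicalSpace X] (x : X) : PointedLocalHomeo X x :=
  ⟨OpenPartialHomeomorph.refl X, by simp, by simp⟩

/-- `f.comp g` is `f ∘ g`, defined wherever the composition makes sense. -/
def comp (f g : PointedLocalHomeo X x) : PointedLocalHomeo X x :=
  ⟨g.toLocalHomeo.trans f.toLocalHomeo,
    by simp [g.mem_source, g.map_base, f.mem_source],
    by simp [g.map_base, f.map_base]⟩

/-- The inverse local homeomorphism. -/
def symm (f : PointedLocalHomeo X x) : PointedLocalHomeo X x :=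
  ⟨f.toLocalHomeo.symm,
    by simpa [f.map_base] using f.toLocalHomeo.map_source f.mem_source,
    by simpa [f.map_base] using f.toLocalHomeo.left_inv f.mem_source⟩

theorem tendsto (f : PointedLocalHomeo X x) : Tendsto f.toLocalHomeo (𝓝 x) (𝓝 x) := by
  simpa [ContinuousAt, f.map_base] using f.toLocalHomeo.continuousAt f.mem_source

theorem eventually_mem_source (f : PointedLocalHomeo X x) :
    ∀ᶠ y in 𝓝 x, y ∈ f.toLocalHomeo.source :=
  f.toLocalHomeo.open_source.mem_nhds f.mem_source

/-- Two local homeomorphisms have the same germ at `x` if they agree near `x`. -/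
instance germSetoid (X : Type u) [TopologicalSpace X] (x : X) :
    Setoid (PointedLocalHomeo X x) where
  r f g := ∀ᶠ y in 𝓝 x, f.toLocalHomeo y = g.toLocalHomeo y
  iseqv :=
    ⟨fun _ => Eventually.of_forall fun _ => rfl,
     fun h => h.mono fun _ hy => hy.symm,
     fun h h' => by filter_upwards [h, h'] with y hy hy' using hy.trans hy'⟩

theorem equiv_def (f g : PointedLocalHomeo X x) :
    f ≈ g ↔ ∀ᶠ y in 𝓝 x, f.toLocalHomeo y = g.toLocalHomeo y := Iff.rfl

theorem comp_congr {f f' g g' : PointedLocalHomeo X x} (hf : f ≈ f') (hg : g ≈ g') :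
    f.comp g ≈ f'.comp g' := by
  rw [equiv_def] at *
  filter_upwards [hg, g.tendsto.eventually hf] with y h1 h2
  simp only [comp, OpenPartialHomeomorph.coe_trans, Function.comp_apply]
  rw [h2, h1]

theorem symm_congr {f g : PointedLocalHomeo X x} (h : f ≈ g) : f.symm ≈ g.symm := by
  rw [equiv_def] at *
  filter_upwards [f.symm.eventually_mem_source, f.symm.tendsto.eventually h,
    f.symm.tendsto.eventually g.eventually_mem_source] with y h1 h2 h3
  simp only [symm] at *
  rw [f.toLocalHomeo.right_inv h1] at h2
  conv_rhs => rw [h2]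
  exact (g.toLocalHomeo.left_inv h3).symm

end PointedLocalHomeo

/-- Germs at `x` of local homeomorphisms of `X` that fix `x`. -/
def HomeoGerm (X : Type u) [TopologicalSpace X] (x : X) : Type u :=
  Quotient (PointedLocalHomeo.germSetoid X x)

namespace HomeoGerm

variable {X : Type u} [TopologicalSpace X] {x : X}

/-- The germ of a local homeomorphism. -/
def mk (f : PointedLocalHomeo X x) : HomeoGerm X x := Quotient.mk _ f

/-- Germs form a group under composition. -/
instance : Group (HomeoGerm X x) where
  mul := Quotient.map₂ PointedLocalHomeo.comp
    fun _ _ hf _ _ hg => PointedLocalHomeo.comp_congr hf hg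
  one := mk (PointedLocalHomeo.refl X x)
  inv := Quotient.map PointedLocalHomeo.symm fun _ _ h => PointedLocalHomeo.symm_congr h
  mul_assoc a b c := by
    induction a using Quotient.inductionOn
    induction b using Quotient.inductionOn
    induction c using Quotient.inductionOn
    exact Quotient.sound (Eventually.of_forall fun _ => rfl)
  one_mul a := by
    induction a using Quotient.inductionOn
    exact Quotient.sound (Eventually.of_forall fun _ => rfl)
  mul_one a := by
    induction a using Quotient.inductionOn
    exact Quotient.sound (Eventually.of_forall fun _ => rfl)
  inv_mul_cancel a := by
    induction a using Quotient.inductionOn with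
    | h f => exact Quotient.sound (f.eventually_mem_source.mono
        fun _ hy => f.toLocalHomeo.left_inv hy)

theorem mk_mul (f g : PointedLocalHomeo X x) : mk f * mk g = mk (f.comp g) := rfl

theorem mk_inv (f : PointedLocalHomeo X x) : (mk f)⁻¹ = mk f.symm := rfl

theorem one_def : (1 : HomeoGerm X x) = mk (PointedLocalHomeo.refl X x) := rfl

theorem mk_eq_mk (f g : PointedLocalHomeo X x) :
    mk f = mk g ↔ ∀ᶠ y in 𝓝 x, f.toLocalHomeo y = g.toLocalHomeo y :=
  Quotient.eq (r := PointedLocalHomeo.germSetoid X x)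

end HomeoGerm

/-- `f` is strictly increasing on a neighbourhood of `x`. -/
def StrictlyIncreasingNear (f : ℝ → ℝ) (x : ℝ) : Prop :=
  ∃ U ∈ 𝓝 x, StrictMonoOn f U

theorem StrictlyIncreasingNear.comp {f g : ℝ → ℝ} {x : ℝ}
    (hg : StrictlyIncreasingNear g (f x)) (hf : StrictlyIncreasingNear f x)
    (hc : ContinuousAt f x) : StrictlyIncreasingNear (fun y => g (f y)) x := by
  obtain ⟨U, hU, hgU⟩ := hg
  obtain ⟨V, hV, hfV⟩ := hf
  exact ⟨V ∩ f ⁻¹' U, inter_mem hV (hc hU),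
    fun a ha b hb hab => hgU ha.2 hb.2 (hfV ha.1 hb.1 hab)⟩

theorem StrictlyIncreasingNear.congr {f g : ℝ → ℝ} {x : ℝ}
    (hf : StrictlyIncreasingNear f x) (h : f =ᶠ[𝓝 x] g) : StrictlyIncreasingNear g x := by
  obtain ⟨U, hU, hfU⟩ := hf
  refine ⟨U ∩ {y | f y = g y}, inter_mem hU h, fun a ha b hb hab => ?_⟩
  have := hfU ha.1 hb.1 hab
  rwa [ha.2, hb.2] at this

theorem StrictlyIncreasingNear.inverse {h k : ℝ → ℝ} {y : ℝ}
    (hh : StrictlyIncreasingNear h (k y)) (hc : ContinuousAt k y)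
    (hk : ∀ᶠ z in 𝓝 y, h (k z) = z) : StrictlyIncreasingNear k y := by
  obtain ⟨U, hU, hhU⟩ := hh
  refine ⟨k ⁻¹' U ∩ {z | h (k z) = z}, inter_mem (hc hU) hk, fun a ha b hb hab => ?_⟩
  rw [← hhU.lt_iff_lt ha.1 hb.1, ha.2, hb.2]
  exact hab

/-- A local homeomorphism of `ℝ` preserves orientation if it is strictly increasing near every
point of its domain (the domain need not be connected). -/
def IsOrientationPreserving (f : OpenPartialHomeomorph ℝ ℝ) : Prop :=
  ∀ x ∈ f.source, StrictlyIncreasingNear f x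

/-- A local homeomorphism of `ℝ × S` of the form `(x, s) ↦ (h_s(x), s)`, where every `h_s` is an
orientation-preserving local homeomorphism of `ℝ` (defined on the open set of all `x` for which
`(x, s)` lies in the domain). -/
structure IsFibredOrientationPreserving {S : Type u} [TopologicalSpace S]
    (f : OpenPartialHomeomorph (ℝ × S) (ℝ × S)) : Prop where
  snd_eq : ∀ p ∈ f.source, (f p).2 = p.2
  increasing : ∀ p ∈ f.source, StrictlyIncreasingNear (fun x => (f (x, p.2)).1) p.1

theorem IsOrientationPreserving.trans {f g : OpenPartialHomeomorph ℝ ℝ}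
    (hf : IsOrientationPreserving f) (hg : IsOrientationPreserving g) :
    IsOrientationPreserving (f.trans g) := by
  intro x hx
  rw [OpenPartialHomeomorph.trans_source] at hx
  exact (hg _ hx.2).comp (hf x hx.1) (f.continuousAt hx.1)

theorem IsOrientationPreserving.symm {f : OpenPartialHomeomorph ℝ ℝ}
    (hf : IsOrientationPreserving f) : IsOrientationPreserving f.symm := fun y hy =>
  (hf _ (f.map_target hy)).inverse (f.symm.continuousAt hy)
    (f.eventually_right_inverse hy)

namespace IsFibredOrientationPreserving

variable {S : Type u} [TopologicalSpace S] {f g : OpenPartialHomeomorph (ℝ × S) (ℝ × S)}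

theorem continuousAt_fst (f : OpenPartialHomeomorph (ℝ × S) (ℝ × S)) {p : ℝ × S}
    (hp : p ∈ f.source) : ContinuousAt (fun x => (f (x, p.2)).1) p.1 := by
  have h : ContinuousAt (fun x : ℝ => (x, p.2)) p.1 := by fun_prop
  exact (ContinuousAt.comp (f := fun x : ℝ => (x, p.2)) (g := f) (f.continuousAt hp) h).fst

theorem eventually_slice {p : ℝ × S} {P : ℝ × S → Prop} (h : ∀ᶠ q in 𝓝 p, P q) :
    ∀ᶠ x in 𝓝 p.1, P (x, p.2) := by
  have hc : ContinuousAt (fun x : ℝ => (x, p.2)) p.1 := by fun_prop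
  exact hc.eventually h

theorem trans (hf : IsFibredOrientationPreserving f) (hg : IsFibredOrientationPreserving g) :
    IsFibredOrientationPreserving (f.trans g) := by
  constructor
  · intro p hp
    rw [OpenPartialHomeomorph.trans_source] at hp
    simp only [OpenPartialHomeomorph.coe_trans, Function.comp_apply]
    rw [hg.snd_eq _ hp.2, hf.snd_eq _ hp.1]
  · intro p hp
    rw [OpenPartialHomeomorph.trans_source] at hp
    have hs : (f p).2 = p.2 := hf.snd_eq p hp.1
    have h1 := hg.increasing _ hp.2
    rw [hs] at h1
    refine (StrictlyIncreasingNear.comp (f := fun x => (f (x, p.2)).1) h1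
      (hf.increasing p hp.1) (continuousAt_fst f hp.1)).congr ?_
    filter_upwards [eventually_slice (f.open_source.mem_nhds hp.1)] with x hx
    have : f (x, p.2) = ((f (x, p.2)).1, p.2) := Prod.ext rfl (hf.snd_eq _ hx)
    simp only [OpenPartialHomeomorph.coe_trans, Function.comp_apply]
    rw [← this]

theorem symm (hf : IsFibredOrientationPreserving f) : IsFibredOrientationPreserving f.symm := by
  have key : ∀ q ∈ f.target, (f.symm q).2 = q.2 := fun q hq => by
    have := hf.snd_eq _ (f.map_target hq)
    rw [f.right_inv hq] at this
    exact this.symm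
  refine ⟨key, fun q hq => ?_⟩
  have h1 := hf.increasing _ (f.map_target hq)
  rw [key q hq] at h1
  refine StrictlyIncreasingNear.inverse h1 (continuousAt_fst f.symm hq) ?_
  filter_upwards [eventually_slice (f.open_target.mem_nhds hq)] with x hx
  have : f.symm (x, q.2) = ((f.symm (x, q.2)).1, q.2) := Prod.ext rfl (key _ hx)
  rw [← this, f.right_inv hx]

end IsFibredOrientationPreserving

/-- The group `Homeo₊(ℝ)` of orientation-preserving (that is, strictly increasing)
homeomorphisms of the real line. -/
def HomeoPlus : Subgroup (ℝ ≃ₜ ℝ) where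
  carrier := {f | StrictMono f}
  mul_mem' := fun {f g} hf hg => show StrictMono (f ∘ g) from StrictMono.comp hf hg
  one_mem' := strictMono_id
  inv_mem' := by
    intro f hf a b hab
    change f.symm a < f.symm b
    have hf' : StrictMono f := hf
    rw [← hf'.lt_iff_lt]
    simpa using hab

/-- The group of germs at the origin of orientation-preserving local homeomorphisms of the real
line fixing the origin. -/
def GermHomeoPlus : Subgroup (HomeoGerm ℝ 0) where
  carrier := {γ | ∃ f : PointedLocalHomeo ℝ 0,
    IsOrientationPreserving f.toLocalHomeo ∧ HomeoGerm.mk f = γ}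
  mul_mem' := by
    rintro _ _ ⟨f, hf, rfl⟩ ⟨g, hg, rfl⟩
    exact ⟨f.comp g, hg.trans hf, rfl⟩
  one_mem' := ⟨PointedLocalHomeo.refl ℝ 0, fun _ _ => ⟨Set.univ, univ_mem, fun _ _ _ _ h => h⟩, rfl⟩
  inv_mem' := by
    rintro _ ⟨f, hf, rfl⟩
    exact ⟨f.symm, hf.symm, rfl⟩

/-- The parametrized germ group of a pointed space `(S, s₀)`: germs at `(0, s₀)` of local
homeomorphisms of `ℝ × S` of the form `(x, s) ↦ (h_s(x), s)` that fix `(0, s₀)`, with every `h_s`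
an orientation-preserving local homeomorphism of `ℝ`. -/
def ParamGermHomeoPlus (S : Type u) [TopologicalSpace S] (s₀ : S) :
    Subgroup (HomeoGerm (ℝ × S) (0, s₀)) where
  carrier := {γ | ∃ f : PointedLocalHomeo (ℝ × S) (0, s₀),
    IsFibredOrientationPreserving f.toLocalHomeo ∧ HomeoGerm.mk f = γ}
  mul_mem' := by
    rintro _ _ ⟨f, hf, rfl⟩ ⟨g, hg, rfl⟩
    exact ⟨f.comp g, hg.trans hf, rfl⟩
  one_mem' := ⟨PointedLocalHomeo.refl _ _,
    ⟨fun _ _ => rfl, fun _ _ => ⟨Set.univ, univ_mem, fun _ _ _ _ h => h⟩⟩, rfl⟩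
  inv_mem' := by
    rintro _ ⟨f, hf, rfl⟩
    exact ⟨f.symm, hf.symm, rfl⟩

/-- The subset `{0} ∪ {1/n : n ≥ 1}` of `ℝ`; as a type it carries the subspace topology. -/
def zeroAndReciprocals : Set ℝ := {0} ∪ {x | ∃ n : ℕ, 0 < n ∧ x = 1 / (n : ℝ)}

/-- The base point `0`. -/
def zeroAndReciprocals.base : zeroAndReciprocals := ⟨0, Or.inl rfl⟩

/-- There is a group homomorphism from `G` to `H` which is not constantly the identity. -/
def HasNontrivialHom (G : Type u) (H : Type v) [Group G] [Group H] : Prop :=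
  ∃ φ : G →* H, ∃ g : G, φ g ≠ 1

end

/-! All four statements are equivalent to `G` acting non-trivially on `ℚ` by order automorphisms,
and the bridge is a total left-invariant preorder on `G` in which some `g` is not equivalent to `1`.
Left multiplication then acts on the countable chain `A` of equivalence classes and moves the class
of `1`; by Cantor's theorem `A ×ₗ ℚ` is isomorphic to `ℚ` (`hasNontrivialHom_rat_of_preorder`).

An action on `ℝ` yields such a preorder by comparing the images of a moved point. Germs have no
common domain and hence no orbits. Instead, representatives are compared along an ultrafilter
converging to the base point and concentrated where a non-trivial germ differs from the identity: it
plays the role of a moved point infinitely near the base point.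

Conversely, an action on `ℚ` extends to `ℝ` by monotonicity. For germs, copies of it are first made
to accumulate at a fixed point (`PinchedLex`). Constant families then give parametrized germs. -/

noncomputable section

/-! ### Group actions by order automorphisms -/

section OrderAction

/-- An action of a group by monotone maps, as a homomorphism to the order automorphisms. -/
def orderIsoHomOfMonotone {G : Type*} {X : Type*} [Group G] [Preorder X] (a : G → X → X)
    (mono : ∀ g, Monotone (a g)) (one : ∀ x, a 1 x = x)
    (mul : ∀ g h x, a (g * h) x = a g (a h x)) : G →* (X ≃o X) where
  toFun g := Equiv.toOrderIso
    ⟨a g, a g⁻¹, fun x => by rw [← mul, inv_mul_cancel, one],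
      fun x => by rw [← mul, mul_inv_cancel, one]⟩ (mono g) (mono g⁻¹)
  map_one' := RelIso.ext one
  map_mul' g h := RelIso.ext (mul g h)

@[simp]
theorem orderIsoHomOfMonotone_apply {G : Type*} {X : Type*} [Group G] [Preorder X]
    (a : G → X → X) (mono : ∀ g, Monotone (a g)) (one : ∀ x, a 1 x = x)
    (mul : ∀ g h x, a (g * h) x = a g (a h x)) (g : G) (x : X) :
    orderIsoHomOfMonotone a mono one mul g x = a g x := rfl

/-- Conjugation by an order isomorphism. -/
def orderIsoConjHom {X Y : Type*} [Preorder X] [Preorder Y] (e : X ≃o Y) :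
    (X ≃o X) →* (Y ≃o Y) :=
  orderIsoHomOfMonotone (fun f y => e (f (e.symm y)))
    (fun f => e.monotone.comp (f.monotone.comp e.symm.monotone))
    (fun y => by simp) (fun f g y => by simp)

@[simp]
theorem orderIsoConjHom_apply {X Y : Type*} [Preorder X] [Preorder Y] (e : X ≃o Y)
    (f : X ≃o X) (y : Y) : orderIsoConjHom e f y = e (f (e.symm y)) := rfl

/-- The action on the second factor of `X ×ₗ Y`. -/
def orderIsoLexLeftHom (X Y : Type*) [PartialOrder X] [Preorder Y] :
    (X ≃o X) →* (X ×ₗ Y ≃o X ×ₗ Y) :=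
  orderIsoHomOfMonotone (fun f p => toLex (f (ofLex p).1, (ofLex p).2))
    (fun f p q h => by
      rw [Prod.Lex.le_iff] at h ⊢
      simpa using h)
    (fun _ => rfl) (fun _ _ _ => rfl)

/-- A countable group with a total left-invariant preorder for which some element is not
equivalent to the identity acts non-trivially on the rationals. -/
theorem hasNontrivialHom_rat_of_preorder {G : Type*} [Group G] [Countable G] [Preorder G]
    (total : ∀ a b : G, a ≤ b ∨ b ≤ a) (left : ∀ k a b : G, a ≤ b → k * a ≤ k * b)
    {g : G} (hg : ¬ (g ≤ 1 ∧ 1 ≤ g)) : HasNontrivialHom G (ℚ ≃o ℚ) := by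
  classical
  have : Std.Total (α := G) (· ≤ ·) := ⟨total⟩
  let A := Antisymmetrization G (· ≤ ·)
  have : Countable A := Quotient.countable
  have : Nonempty A := ⟨toAntisymmetrization _ 1⟩
  have : Countable (A ×ₗ ℚ) := inferInstanceAs (Countable (A × ℚ))
  let m : G → (G →o G) := fun k => ⟨fun x => k * x, fun a b => left k a b⟩
  let ρ : G →* (A ≃o A) := orderIsoHomOfMonotone (fun k => (m k).antisymmetrization)
    (fun k => (m k).antisymmetrization.monotone)
    (fun x => by
      induction x using Antisymmetrization.ind
      simp [m])
    (fun k l x => by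
      induction x using Antisymmetrization.ind
      exact congrArg _ (mul_assoc _ _ _))
  -- `A` may have gaps or endpoints; replacing each point by a copy of `ℚ` removes both.
  obtain ⟨e⟩ := Order.iso_of_countable_dense (A ×ₗ ℚ) ℚ
  refine ⟨((orderIsoConjHom e).comp (orderIsoLexLeftHom A ℚ)).comp ρ, g, fun h => hg ?_⟩
  have h1 := DFunLike.congr_fun h (e (toLex (toAntisymmetrization _ 1, 0)))
  have h2 : orderIsoLexLeftHom A ℚ (ρ g) (toLex (toAntisymmetrization _ 1, 0)) =
      toLex (toAntisymmetrization _ 1, 0) := by simpa using h1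
  have h3 : ρ g (toAntisymmetrization _ 1) = toAntisymmetrization _ 1 :=
    congrArg (fun p => (ofLex p).1) h2
  have h4 : toAntisymmetrization (α := G) (· ≤ ·) g = toAntisymmetrization _ 1 := by
    have h5 : toAntisymmetrization (α := G) (· ≤ ·) (g * 1) = toAntisymmetrization _ 1 := h3
    rwa [mul_one] at h5
  exact ⟨toAntisymmetrization_le_toAntisymmetrization_iff.1 h4.le,
    toAntisymmetrization_le_toAntisymmetrization_iff.1 h4.ge⟩

end OrderAction

/-! ### Extension of order automorphisms from the rationals to the reals -/

section Extension

/-- The monotone extension of an order automorphism of `ℚ` to `ℝ`. -/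
def ratExtend (f : ℚ ≃o ℚ) (x : ℝ) : ℝ := sSup ((fun q : ℚ => (f q : ℝ)) '' {q | (q : ℝ) ≤ x})

theorem ratExtend_bddAbove (f : ℚ ≃o ℚ) (x : ℝ) :
    BddAbove ((fun q : ℚ => (f q : ℝ)) '' {q | (q : ℝ) ≤ x}) := by
  obtain ⟨r, hr⟩ := exists_rat_gt x
  refine ⟨f r, ?_⟩
  rintro _ ⟨q, hq, rfl⟩
  have hqr : q ≤ r := by exact_mod_cast (le_trans hq hr.le : (q : ℝ) ≤ r)
  exact Rat.cast_le.2 (f.monotone hqr)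

theorem ratExtend_monotone (f : ℚ ≃o ℚ) : Monotone (ratExtend f) := by
  intro x y hxy
  -- The smaller set must be nonempty, since `sSup ∅ = 0` in `ℝ`.
  obtain ⟨r, hr⟩ := exists_rat_lt x
  exact csSup_le_csSup (ratExtend_bddAbove f y) ⟨_, r, hr.le, rfl⟩
    (Set.image_mono fun q hq => le_trans hq hxy)

theorem ratExtend_ratCast (f : ℚ ≃o ℚ) (q : ℚ) : ratExtend f q = f q := by
  refine IsGreatest.csSup_eq ⟨⟨q, le_refl (q : ℝ), rfl⟩, ?_⟩
  rintro _ ⟨r, hr, rfl⟩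
  exact Rat.cast_le.2 (f.monotone (Rat.cast_le.1 (show (r : ℝ) ≤ q from hr)))

/-- The values on `ℚ` already fill `ℚ`, which is dense, so monotonicity leaves no freedom and
continuity need not be assumed. This makes the extension multiplicative. -/
theorem ratExtend_unique {f : ℚ ≃o ℚ} {F F' : ℝ → ℝ} (hF : Monotone F) (hF' : Monotone F')
    (h : ∀ q : ℚ, F q = f q) (h' : ∀ q : ℚ, F' q = f q) : F = F' := by
  have key : ∀ {F F' : ℝ → ℝ}, Monotone F → Monotone F' → (∀ q : ℚ, F q = f q) →
      (∀ q : ℚ, F' q = f q) → ∀ x, F' x ≤ F x := by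
    intro F F' hF hF' h h' x
    by_contra! hlt
    -- Both maps take the value `r` at `f.symm r`, which would have to lie on both sides of `x`.
    obtain ⟨r, hr1, hr2⟩ := exists_rat_btwn hlt
    have e1 : F (f.symm r) = r := by rw [h, f.apply_symm_apply]
    have e2 : F' (f.symm r) = r := by rw [h', f.apply_symm_apply]
    rw [← e1] at hr1
    rw [← e2] at hr2
    exact lt_asymm (hF.reflect_lt hr1) (hF'.reflect_lt hr2)
  exact funext fun x => le_antisymm (key hF' hF h' h x) (key hF hF' h h' x)

/-- Extension of order automorphisms from `ℚ` to `ℝ` is a homomorphism. -/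
def ratExtendHom : (ℚ ≃o ℚ) →* (ℝ ≃o ℝ) :=
  orderIsoHomOfMonotone ratExtend ratExtend_monotone
    (fun x => congrFun (ratExtend_unique (f := 1) (ratExtend_monotone 1) monotone_id
      (ratExtend_ratCast 1) fun _ => rfl) x)
    (fun f g x => congrFun (ratExtend_unique (f := f * g) (ratExtend_monotone _)
      ((ratExtend_monotone f).comp (ratExtend_monotone g)) (ratExtend_ratCast _)
      fun q => by simp [ratExtend_ratCast]) x)

@[simp]
theorem ratExtendHom_ratCast (f : ℚ ≃o ℚ) (q : ℚ) : ratExtendHom f q = f q :=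
  ratExtend_ratCast f q

/-- Order automorphisms of the line are orientation-preserving homeomorphisms. -/
def orderIsoToHomeoPlus : (ℝ ≃o ℝ) →* HomeoPlus where
  toFun f := ⟨f.toHomeomorph, f.strictMono⟩
  map_one' := rfl
  map_mul' _ _ := rfl

theorem HasNontrivialHom.homeoPlus_of_rat {G : Type*} [Group G]
    (h : HasNontrivialHom G (ℚ ≃o ℚ)) : HasNontrivialHom G HomeoPlus := by
  obtain ⟨φ, g, hg⟩ := h
  refine ⟨(orderIsoToHomeoPlus.comp ratExtendHom).comp φ, g, fun h1 => hg (RelIso.ext fun q => ?_)⟩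
  have h2 : ratExtendHom (φ g) q = q := congrArg (fun f : HomeoPlus => f.1 (q : ℝ)) h1
  rw [ratExtendHom_ratCast] at h2
  exact_mod_cast h2

/-- Elements of `G` are ordered by where they send a point moved by `g`; left invariance holds
because every `φ k` is increasing. -/
theorem HasNontrivialHom.rat_of_homeoPlus {G : Type*} [Group G] [Countable G]
    (h : HasNontrivialHom G HomeoPlus) : HasNontrivialHom G (ℚ ≃o ℚ) := by
  obtain ⟨φ, g, hg⟩ := h
  obtain ⟨x, hx⟩ : ∃ x, (φ g).1 x ≠ x := by
    by_contra! hx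
    exact hg (Subtype.ext (Homeomorph.ext hx))
  let : Preorder G := Preorder.lift fun k => (φ k).1 x
  refine hasNontrivialHom_rat_of_preorder (g := g) (fun a b => le_total ((φ a).1 x) ((φ b).1 x))
    (fun k a b hab => ?_) (fun h => hx ?_)
  · change (φ (k * a)).1 x ≤ (φ (k * b)).1 x
    rw [map_mul, map_mul]
    exact (φ k).2.monotone hab
  · have h1 : (φ 1).1 x = x := by rw [map_one]; rfl
    have h2 : (φ g).1 x = (φ 1).1 x := le_antisymm h.1 h.2
    rw [h2, h1]

end Extension

/-! ### Actions near a fixed point -/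

section FixedPoint

/-- Countably many copies of `ℚ`, ordered like `ℚ`, with the copy at `0` collapsed to a point. -/
abbrev PinchedLex : Type := {p : ℚ ×ₗ ℚ // (ofLex p).1 = 0 → (ofLex p).2 = 0}

namespace PinchedLex

/-- The centre of the copy indexed by `a`. -/
def center (a : ℚ) : PinchedLex := ⟨toLex (a, 0), fun _ => rfl⟩

instance : Nonempty PinchedLex := ⟨center 0⟩

instance : Countable PinchedLex :=
  have : Countable (ℚ ×ₗ ℚ) := inferInstanceAs (Countable (ℚ × ℚ))
  inferInstance

instance : NoMaxOrder PinchedLex :=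
  ⟨fun p => ⟨center ((ofLex p.1).1 + 1), Prod.Lex.lt_iff.2 (Or.inl (lt_add_one _))⟩⟩

instance : NoMinOrder PinchedLex :=
  ⟨fun p => ⟨center ((ofLex p.1).1 - 1), Prod.Lex.lt_iff.2 (Or.inl (sub_one_lt _))⟩⟩

instance : DenselyOrdered PinchedLex := by
  refine ⟨fun p q hpq => ?_⟩
  rcases Prod.Lex.lt_iff.1 (show p.1 < q.1 from hpq) with h | ⟨h, h'⟩
  · obtain ⟨c, hc⟩ := exists_between h
    exact ⟨center c, Prod.Lex.lt_iff.2 (Or.inl hc.1), Prod.Lex.lt_iff.2 (Or.inl hc.2)⟩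
  -- Two distinct points of the same copy cannot lie in the collapsed one, so a full copy of `ℚ` is
  -- available.
  · have h0 : (ofLex p.1).1 ≠ 0 := fun h0 => by
      rw [p.2 h0, q.2 (h ▸ h0)] at h'
      exact lt_irrefl _ h'
    obtain ⟨c, hc⟩ := exists_between h'
    exact ⟨⟨toLex ((ofLex p.1).1, c), fun h1 => absurd h1 h0⟩,
      Prod.Lex.lt_iff.2 (Or.inr ⟨rfl, hc.1⟩), Prod.Lex.lt_iff.2 (Or.inr ⟨h, hc.2⟩)⟩

/-- The simultaneous action on all copies of `ℚ`. -/
def actionHom : (ℚ ≃o ℚ) →* (PinchedLex ≃o PinchedLex) :=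
  orderIsoHomOfMonotone
    (fun f p => ⟨toLex ((ofLex p.1).1, if (ofLex p.1).1 = 0 then 0 else f (ofLex p.1).2),
      fun h => if_pos h⟩)
    (fun f p q h => by
      have h1 := Prod.Lex.le_iff.1 (show p.1 ≤ q.1 from h)
      refine Prod.Lex.le_iff.2 (h1.imp id fun ⟨h2, h3⟩ => ⟨h2, ?_⟩)
      by_cases h0 : (ofLex q.1).1 = 0
      · simp [h2, h0]
      · simpa [h2, h0] using h3)
    (fun p => by
      refine Subtype.ext (Prod.ext rfl ?_)
      by_cases h0 : (ofLex p.1).1 = 0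
      · exact (if_pos h0).trans (p.2 h0).symm
      · exact if_neg h0)
    (fun f g p => by
      refine Subtype.ext (Prod.ext rfl ?_)
      by_cases h0 : (ofLex p.1).1 = 0
      · simp [h0]
      · simp [h0])

theorem actionHom_center_zero (f : ℚ ≃o ℚ) : actionHom f (center 0) = center 0 :=
  Subtype.ext (Prod.ext rfl (if_pos (e := f 0) (rfl : (0 : ℚ) = 0)))

end PinchedLex

open PinchedLex in
/-- A group acting non-trivially on `ℚ` acts on `ℚ` with a fixed point near which some element
moves points. -/
theorem HasNontrivialHom.exists_rat_fixing_zero {G : Type*} [Group G]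
    (h : HasNontrivialHom G (ℚ ≃o ℚ)) : ∃ φ : G →* (ℚ ≃o ℚ), (∀ g, φ g 0 = 0) ∧
      ∃ g, ∀ r : ℚ, 0 < r → ∃ q, 0 < q ∧ q < r ∧ φ g q ≠ q := by
  obtain ⟨φ, g, hg⟩ := h
  obtain ⟨b, hb⟩ : ∃ b, φ g b ≠ b := by
    by_contra! hb
    exact hg (RelIso.ext hb)
  obtain ⟨e₀⟩ := Order.iso_of_countable_dense PinchedLex ℚ
  -- Cantor's isomorphism need not send the pinched point to `0`; a translation corrects this.
  let e : PinchedLex ≃o ℚ := e₀.trans (OrderIso.addRight (-e₀ (center 0)))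
  have he : e (center 0) = 0 := add_neg_cancel _
  have he' : e.symm 0 = center 0 := e.symm_apply_eq.2 he.symm
  refine ⟨((orderIsoConjHom e).comp actionHom).comp φ, fun k => ?_, g, fun r hr => ?_⟩
  · simp [he', actionHom_center_zero, he]
  · have h1 : center 0 < e.symm r := by rwa [← he', e.symm.lt_iff_lt]
    have ha : 0 < (ofLex (e.symm r).1).1 := by
      rcases Prod.Lex.lt_iff.1 (show (center 0).1 < (e.symm r).1 from h1) with h | ⟨h, h'⟩
      · exact h
      · rw [(e.symm r).2 h.symm] at h'
        exact absurd h' (lt_irrefl _)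
    -- The whole copy with index `a` lies between the fixed point and `e.symm r`, and there `g`
    -- moves the point with coordinate `b`.
    obtain ⟨a, ha0, har⟩ := exists_between ha
    let p : PinchedLex := ⟨toLex (a, b), fun h => absurd h ha0.ne'⟩
    refine ⟨e p, ?_, ?_, fun hp => hb ?_⟩
    · refine he.symm.trans_lt (e.lt_iff_lt.2 ?_)
      exact Prod.Lex.lt_iff.2 (Or.inl ha0)
    · rw [← e.lt_symm_apply]
      exact Prod.Lex.lt_iff.2 (Or.inl har)
    · have h2 : actionHom (φ g) p = p := by simpa using hp
      have h3 : (if a = 0 then 0 else φ g b) = b :=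
        congrArg (fun p : PinchedLex => (ofLex p.1).2) h2
      rwa [if_neg ha0.ne'] at h3

/-- An order automorphism of the line fixing the origin, as a local homeomorphism. -/
def pointedOfOrderIso (f : ℝ ≃o ℝ) (hf : f 0 = 0) : PointedLocalHomeo ℝ 0 :=
  ⟨f.toHomeomorph.toOpenPartialHomeomorph, trivial, hf⟩

theorem HasNontrivialHom.germHomeoPlus_of_rat {G : Type*} [Group G]
    (h : HasNontrivialHom G (ℚ ≃o ℚ)) : HasNontrivialHom G GermHomeoPlus := by
  obtain ⟨φ, h0, g, hg⟩ := h.exists_rat_fixing_zero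
  have hfix : ∀ k, ratExtendHom (φ k) 0 = 0 := fun k => by
    simpa [h0 k] using ratExtendHom_ratCast (φ k) 0
  let ψ : G →* GermHomeoPlus := MonoidHom.mk'
    (fun k => ⟨HomeoGerm.mk (pointedOfOrderIso (ratExtendHom (φ k)) (hfix k)),
      pointedOfOrderIso (ratExtendHom (φ k)) (hfix k),
      fun _ _ => ⟨Set.univ, univ_mem, (ratExtendHom (φ k)).strictMono.strictMonoOn _⟩, rfl⟩)
    (fun k l => Subtype.ext ((HomeoGerm.mk_eq_mk _ _).2 (Eventually.of_forall fun x =>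
      show ratExtendHom (φ (k * l)) x = ratExtendHom (φ k) (ratExtendHom (φ l) x) by
        rw [map_mul, map_mul]; rfl)))
  refine ⟨ψ, g, fun h1 => ?_⟩
  have h2 : ∀ᶠ y in 𝓝 (0 : ℝ), ratExtendHom (φ g) y = y :=
    (HomeoGerm.mk_eq_mk _ _).1 (congrArg Subtype.val h1)
  obtain ⟨ε, hε, hball⟩ := Metric.eventually_nhds_iff.1 h2
  obtain ⟨r, hr0, hrε⟩ := exists_rat_btwn hε
  obtain ⟨q, hq0, hqr, hq⟩ := hg r (by exact_mod_cast hr0)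
  have hq0' : (0 : ℝ) < q := by exact_mod_cast hq0
  have hqr' : (q : ℝ) < r := by exact_mod_cast hqr
  have h3 := @hball (q : ℝ) (by rw [Real.dist_eq, sub_zero, abs_of_pos hq0']; linarith)
  rw [ratExtendHom_ratCast] at h3
  exact hq (by exact_mod_cast h3)

end FixedPoint

/-! ### Parametrized germs -/

section Parametrized

namespace PointedLocalHomeo

/-- The product of a local homeomorphism with the identity of `S`. -/
def prodId {X : Type*} [TopologicalSpace X] {x : X} (f : PointedLocalHomeo X x) {S : Type*}
    [TopologicalSpace S] (s₀ : S) : PointedLocalHomeo (X × S) (x, s₀) :=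
  ⟨f.toLocalHomeo.prod (OpenPartialHomeomorph.refl S), ⟨f.mem_source, trivial⟩,
    Prod.ext f.map_base rfl⟩

end PointedLocalHomeo

/-- Constant families of germs. -/
def HomeoGerm.prodIdHom {X : Type*} [TopologicalSpace X] {x : X} {S : Type*}
    [TopologicalSpace S] (s₀ : S) : HomeoGerm X x →* HomeoGerm (X × S) (x, s₀) :=
  MonoidHom.mk'
    (Quotient.map (fun f => f.prodId s₀) fun f g h => by
      rw [PointedLocalHomeo.equiv_def] at h ⊢
      filter_upwards [continuous_fst.continuousAt.eventually h] with p hp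
      exact Prod.ext hp rfl)
    (fun a b => by
      induction a using Quotient.inductionOn
      induction b using Quotient.inductionOn
      exact Quotient.sound (Eventually.of_forall fun _ => rfl))

/-- Restriction to the slice over `s₀` recovers the original germ. -/
theorem HomeoGerm.prodIdHom_injective {X : Type*} [TopologicalSpace X] {x : X} {S : Type*}
    [TopologicalSpace S] (s₀ : S) :
    Function.Injective (HomeoGerm.prodIdHom (x := x) s₀) := by
  intro a b h
  induction a using Quotient.inductionOn with | h f => ?_
  induction b using Quotient.inductionOn with | h g => ?_
  have h1 := (HomeoGerm.mk_eq_mk (f.prodId s₀) (g.prodId s₀)).1 h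
  refine (HomeoGerm.mk_eq_mk f g).2 ?_
  have hc : ContinuousAt (fun y : X => (y, s₀)) x := by fun_prop
  filter_upwards [hc.eventually h1] with y hy
  exact congrArg Prod.fst hy

theorem HasNontrivialHom.paramGermHomeoPlus {G : Type*} [Group G]
    (h : HasNontrivialHom G GermHomeoPlus) {S : Type*} [TopologicalSpace S] (s₀ : S) :
    HasNontrivialHom G (ParamGermHomeoPlus S s₀) := by
  obtain ⟨φ, g, hg⟩ := h
  have hmem : ∀ γ : GermHomeoPlus, HomeoGerm.prodIdHom s₀ γ.1 ∈ ParamGermHomeoPlus S s₀ := by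
    rintro ⟨_, f, hf, rfl⟩
    exact ⟨f.prodId s₀, ⟨fun _ _ => rfl, fun p hp => hf p.1 hp.1⟩, rfl⟩
  refine ⟨(((HomeoGerm.prodIdHom s₀).comp GermHomeoPlus.subtype).codRestrict
    (ParamGermHomeoPlus S s₀) hmem).comp φ, g, fun h1 => hg ?_⟩
  have h2 : HomeoGerm.prodIdHom s₀ (φ g).1 = 1 := congrArg Subtype.val h1
  rw [← map_one (HomeoGerm.prodIdHom s₀)] at h2
  exact Subtype.ext (HomeoGerm.prodIdHom_injective s₀ h2)

/-- A continuous function on an interval that is locally strictly increasing is monotone. -/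
theorem monotoneOn_of_strictlyIncreasingNear {f : ℝ → ℝ} {I : Set ℝ} (hI : I.OrdConnected)
    (hf : ∀ x ∈ I, StrictlyIncreasingNear f x) (hc : ∀ x ∈ I, ContinuousAt f x) :
    MonotoneOn f I := by
  intro a ha b hb hab
  have hsub : Set.Icc a b ⊆ I := hI.out ha hb
  have hcont : ContinuousOn f (Set.Icc a b) := fun x hx => (hc x (hsub hx)).continuousWithinAt
  -- Continuous induction along `[a, b]`: the set where `f a ≤ f x` is closed, and local increase
  -- continues it to the right of each of its points before `b`.
  have hclosed : IsClosed ({x | f a ≤ f x} ∩ Set.Icc a b) := by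
    have := hcont.preimage_isClosed_of_isClosed isClosed_Icc (isClosed_Ici (a := f a))
    rwa [Set.inter_comm] at this
  refine hclosed.mem_of_ge_of_forall_exists_gt (le_refl (f a)) hab fun x hx => ?_
  obtain ⟨U, hU, hfU⟩ := hf x (hsub ⟨hx.2.1, hx.2.2.le⟩)
  obtain ⟨y, hyU, hy⟩ : (U ∩ Set.Ioc x b).Nonempty :=
    (inter_mem (mem_nhdsWithin_of_mem_nhds hU) (Ioc_mem_nhdsGT hx.2.2) :
      U ∩ Set.Ioc x b ∈ 𝓝[>] x) |> Filter.nonempty_of_mem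
  exact ⟨y, le_trans hx.1 (hfU (mem_of_mem_nhds hU) hyU hy.1).le, hy⟩

/-- The fibre maps of a fibred orientation-preserving local homeomorphism are monotone on a
common interval, uniformly in the parameter. -/
theorem IsFibredOrientationPreserving.exists_monotoneOn {S : Type*} [TopologicalSpace S] {x₀ : ℝ}
    {s₀ : S} {f : OpenPartialHomeomorph (ℝ × S) (ℝ × S)} (hf : IsFibredOrientationPreserving f)
    (h0 : (x₀, s₀) ∈ f.source) : ∃ I ∈ 𝓝 x₀, ∃ V ∈ 𝓝 s₀, ∀ s ∈ V,
      MonotoneOn (fun x => (f (x, s)).1) I := by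
  obtain ⟨W, hW, V, hV, hWV⟩ := mem_nhds_prod_iff.1 (f.open_source.mem_nhds h0)
  obtain ⟨ε, hε, hball⟩ := Metric.mem_nhds_iff.1 hW
  -- A product neighbourhood supplies one interval for all nearby fibres. An interval is needed: a
  -- fibre of the full domain may be disconnected, and local increase does not compare different
  -- components.
  refine ⟨Metric.ball x₀ ε, Metric.ball_mem_nhds _ hε, V, hV, fun s hs => ?_⟩
  have hmem : ∀ x ∈ Metric.ball x₀ ε, (x, s) ∈ f.source := fun x hx => hWV ⟨hball hx, hs⟩
  refine monotoneOn_of_strictlyIncreasingNear ?_ (fun x hx => hf.increasing _ (hmem x hx))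
    (fun x hx => IsFibredOrientationPreserving.continuousAt_fst f (hmem x hx))
  rw [Real.ball_eq_Ioo]
  exact Set.ordConnected_Ioo

theorem HasNontrivialHom.rat_of_paramGermHomeoPlus {G : Type*} [Group G] [Countable G]
    {S : Type*} [TopologicalSpace S] {s₀ : S}
    (h : HasNontrivialHom G (ParamGermHomeoPlus S s₀)) : HasNontrivialHom G (ℚ ≃o ℚ) := by
  obtain ⟨φ, g, hg⟩ := h
  choose F hF hFφ using fun k => (φ k).2
  have hcomp : ∀ k l, ∀ᶠ p in 𝓝 ((0 : ℝ), s₀),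
      (F (k * l)).toLocalHomeo p = (F k).toLocalHomeo ((F l).toLocalHomeo p) := fun k l => by
    refine (HomeoGerm.mk_eq_mk (F (k * l)) ((F k).comp (F l))).1 ?_
    rw [← HomeoGerm.mk_mul, hFφ, hFφ, hFφ, map_mul]
    rfl
  have hsnd : ∀ k, ∀ᶠ p in 𝓝 ((0 : ℝ), s₀), ((F k).toLocalHomeo p).2 = p.2 := fun k =>
    (F k).eventually_mem_source.mono (hF k).snd_eq
  -- `F 1` represents the identity germ but need not be the identity map, so `F g` is compared with
  -- `F 1` itself, as in the preorder below.
  have hne : ∃ᶠ p in 𝓝 ((0 : ℝ), s₀), (F g).toLocalHomeo p ≠ (F 1).toLocalHomeo p := by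
    intro h
    refine hg (Subtype.ext ?_)
    rw [← map_one φ, ← hFφ, ← hFφ, HomeoGerm.mk_eq_mk]
    simpa using h
  have : NeBot (𝓝 ((0 : ℝ), s₀) ⊓ 𝓟 {p | (F g).toLocalHomeo p ≠ (F 1).toLocalHomeo p}) :=
    frequently_mem_iff_neBot.1 hne
  let U : Ultrafilter (ℝ × S) :=
    Ultrafilter.of (𝓝 ((0 : ℝ), s₀) ⊓ 𝓟 {p | (F g).toLocalHomeo p ≠ (F 1).toLocalHomeo p})
  have hU : (U : Filter (ℝ × S)) ≤ 𝓝 ((0 : ℝ), s₀) := (Ultrafilter.of_le _).trans inf_le_left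
  have hUne : ∀ᶠ p in U, (F g).toLocalHomeo p ≠ (F 1).toLocalHomeo p :=
    ((Ultrafilter.of_le _).trans inf_le_right) (mem_principal_self _)
  let : Preorder G :=
    { le := fun a b => ∀ᶠ p in U, ((F a).toLocalHomeo p).1 ≤ ((F b).toLocalHomeo p).1
      le_refl := fun _ => Eventually.of_forall fun _ => le_rfl
      le_trans := fun _ _ _ h h' => by filter_upwards [h, h'] with p hp hp' using hp.trans hp' }
  refine hasNontrivialHom_rat_of_preorder (g := g) (fun a b => ?_) (fun k a b hab => ?_)
    (fun h => ?_)
  -- Totality is where an ultrafilter is needed: it decides which of the two inequalities holds.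
  · exact Ultrafilter.eventually_or.1 (Eventually.of_forall fun p => le_total _ _)
  -- Near the base point `F a p` and `F b p` stay in the fibre of `p` and in the region where `F k`
  -- is fibrewise monotone.
  · obtain ⟨I, hI, V, hV, hmono⟩ := (hF k).exists_monotoneOn (F k).mem_source
    have hmem : ∀ l, ∀ᶠ p in 𝓝 ((0 : ℝ), s₀), (F l).toLocalHomeo p ∈ I ×ˢ V := fun l =>
      (F l).tendsto.eventually (prod_mem_nhds hI hV)
    change ∀ᶠ p in U, ((F (k * a)).toLocalHomeo p).1 ≤ ((F (k * b)).toLocalHomeo p).1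
    filter_upwards [hab, hU (hcomp k a), hU (hcomp k b), hU (hsnd a), hU (hsnd b), hU (hmem a),
      hU (hmem b)] with p hle hka hkb ha hb hma hmb
    rw [hka, hkb]
    have ea : (F a).toLocalHomeo p = (((F a).toLocalHomeo p).1, p.2) := Prod.ext rfl ha
    have eb : (F b).toLocalHomeo p = (((F b).toLocalHomeo p).1, p.2) := Prod.ext rfl hb
    rw [ea, eb]
    exact hmono p.2 (ha ▸ hma.2) hma.1 hmb.1 hle
  -- Equivalence of `g` and `1` would equate both coordinates of `F g p` and `F 1 p` along `U`,
  -- where they differ.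
  · obtain ⟨p, hp, h1, h2, hg2, h12⟩ := (hUne.and (h.1.and (h.2.and
      (((hsnd g).filter_mono hU).and ((hsnd 1).filter_mono hU))))).exists
    exact hp (Prod.ext (le_antisymm h1 h2) (hg2.trans h12.symm))

end Parametrized

end

theorem mainTheorem4 (G : Type v) [Group G] [Countable G] :
    List.TFAE [
      HasNontrivialHom G HomeoPlus,
      HasNontrivialHom G GermHomeoPlus,
      HasNontrivialHom G (ParamGermHomeoPlus zeroAndReciprocals zeroAndReciprocals.base),
      ∃ (S : Type u) (_ : TopologicalSpace S) (_ : TopologicalSpace.MetrizableSpace S) (s₀ : S),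
        HasNontrivialHom G (ParamGermHomeoPlus S s₀)] := by
  tfae_have 1 → 2 := fun h => h.rat_of_homeoPlus.germHomeoPlus_of_rat
  tfae_have 2 → 3 := fun h => h.paramGermHomeoPlus _
  tfae_have 3 → 1 := fun h => h.rat_of_paramGermHomeoPlus.homeoPlus_of_rat
  -- A one-point space exists in every universe, whereas `zeroAndReciprocals` lives in the lowest
  -- one and cannot serve directly.
  tfae_have 2 → 4 := fun h =>
    ⟨PUnit, inferInstance, inferInstance, PUnit.unit, h.paramGermHomeoPlus _⟩
  tfae_have 4 → 1 := fun ⟨_, _, _, _, h⟩ => h.rat_of_paramGermHomeoPlus.homeoPlus_of_rat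
  tfae_finish
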